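/- There are absolute constants $C>0$ and $N\in\mathbb{N}$ such that the following holds for every integer $n\ge N$. Put $l=\lfloor 2n^{1/5}+1\rfloor$, $\rho=1-n^{-4/5}\log^6 n$ (where $\log^m n=(\log n)^m$, natural logarithm) and $A=\{\rho e^{i\theta}:\theta\in\mathbb{R},\ |\theta|\le n^{-2/5}\}$. Let $x=(x_0,x_1,\dots)$ and $y=(y_0,y_1,\dots)$ be infinite binary strings in $\{0,1\}^{\mathbb{N}}$ that agree on their first $n$ bits but differ at the $(n+1)$-th bit, i.e. $x_i=y_i$ for all $0\le i<n$ and $x_n\ne y_n$. Then there are $w\in\{0,1\}^l$ and $z_0\in A$ such that the series below converges absolutely and $$\left|\sum_{k=0}^{\infty}\left[(-1)^{x_k}\mathbf 1_{x(k+1:k+l)=w}-(-1)^{y_k}\mathbf 1_{y(k+1:k+l)=w}\right]z_0^k\right|\ \ge\ \exp\left(-n^{1/5}\log^6 n-C\,n^{1/5}\log^5 n\right),$$ where $x(i:j)=(x_i,x_{i+1},\dots,x_j)$. -/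

import Mathlib

/-- The factor `x(k : k + l - 1) = (x_k, …, x_{k+l-1})` of length `l` of the infinite
binary string `x = (x_0, x_1, …)`. -/
def factor (x : ℕ → Fin 2) (k l : ℕ) : Fin l → Fin 2 :=
  fun i => x (k + (i : ℕ))

/-- `(-1)^{x_k} · 1_{x(k+1 : k+l) = w}`. -/
def signedOccurrence {l : ℕ} (x : ℕ → Fin 2) (w : Fin l → Fin 2) (k : ℕ) : ℂ :=
  (-1 : ℂ) ^ (x k : ℕ) * (if factor x (k + 1) l = w then 1 else 0)

/-- The word length `l = 2 n^{1/5} + 1`, rounded down to an integer. -/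
noncomputable def wordLength (n : ℕ) : ℕ :=
  ⌊2 * (n : ℝ) ^ (1 / 5 : ℝ) + 1⌋₊

/-- The radius `ρ = 1 - n^{-4/5} log^6 n`. -/
noncomputable def arcRadius (n : ℕ) : ℝ :=
  1 - (n : ℝ) ^ (-(4 / 5) : ℝ) * Real.log n ^ 6

/-- The arc `A = {ρ e^{iθ} : |θ| ≤ n^{-2/5}}`. -/
noncomputable def smallArc (n : ℕ) : Set ℂ :=
  {z | ∃ θ : ℝ, |θ| ≤ (n : ℝ) ^ (-(2 / 5) : ℝ) ∧
    z = (arcRadius n : ℂ) * Complex.exp ((θ : ℂ) * Complex.I)}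

/-! The proof combines word combinatorics with complex analysis. Write `p = n^(1/5)`, `T = log n`.

Combinatorics: the length-`l` factors of `x` and `y` ending at position `n` differ only in their
last letter, so they cannot both have periods below about `l/2`. Let `w` be one without such a
period. Occurrences of `w` in either string are then at least about `l/2` apart, and the series
becomes, up to a unimodular factor, `z^(n-l)` times `1 - η z^d + (terms of degree at least L)`, with
`|η| ≤ 1` and `L ≥ p` (`exists_gapSeries_of_ne`). On the arc the power of `z` accounts for the main
factor `exp(-p T^6)` (`exp_le_arcRadius_pow`).

Analysis: the gap series `F` must not be too small on the whole arc. If it is at most `exp(-2M)`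
there, the two-constants theorem (`norm_le_of_norm_le_on_arc`) makes `z ↦ F(ρz)` at most `exp(-M)`,
up to a power of `n`, at all points of the disc close to `1`. Compose with a self-map `h` of the
disc that fixes `0` and approaches the circle only near `1`, and divide by `1 - η (ρh)^d`. The
quotient `g` has `g(0) = 1`, is nearly `1` away from `1` because the tail has high degree, is
polynomially bounded everywhere, and is tiny near `1`. The maximum principle for a product of
rotates of `g` over a regular `m`-gon (`le_of_norm_le_near_one`) then bounds `M` by `O(p T^3)`,
which leaves room below `p T^5`. -/

/-! ### Two-constants estimate for a short arc -/

/-- The Möbius transformation sending the upper half-plane to the unit disc, `1` to `1`, and the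
positive half-line to the arc between `α⁻¹` and `α`, for unimodular `α`. -/
noncomputable def arcMobius (α v : ℂ) : ℂ := (v * α + 1) / (α + v)

theorem arcMobius_denom_ne_zero {α v : ℂ} (hα : 0 < α.im) (hv : 0 ≤ v.im) : α + v ≠ 0 := by
  intro h
  have := congrArg Complex.im h
  simp at this
  linarith

/-- For unimodular `α`, `|α + v|² - |vα + 1|² = 4 Im α Im v`. -/
theorem norm_arcMobius_le_one {α v : ℂ} (hα1 : ‖α‖ = 1) (hα : 0 < α.im) (hv : 0 ≤ v.im) :
    ‖arcMobius α v‖ ≤ 1 := by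
  have hne := arcMobius_denom_ne_zero hα hv
  rw [arcMobius, norm_div, div_le_one (norm_pos_iff.mpr hne)]
  have h1 : α.re * α.re + α.im * α.im = 1 := by
    rw [← Complex.normSq_apply, Complex.normSq_eq_norm_sq, hα1]; norm_num
  refine (sq_le_sq₀ (norm_nonneg _) (norm_nonneg _)).mp ?_
  rw [← Complex.normSq_eq_norm_sq, ← Complex.normSq_eq_norm_sq, Complex.normSq_apply,
    Complex.normSq_apply]
  simp only [Complex.add_re, Complex.mul_re, Complex.one_re, Complex.add_im, Complex.mul_im,
    Complex.one_im]
  have h2 : 0 ≤ α.im * v.im := by positivity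
  have h3 : (v.re * v.re + v.im * v.im) * (α.re * α.re + α.im * α.im)
    = v.re * v.re + v.im * v.im := by rw [h1, mul_one]
  nlinarith

theorem exists_angle_of_cos_le_re {a : ℝ} (ha : 0 ≤ a) {z : ℂ}
    (hz : ‖z‖ = 1) (h : Real.cos a ≤ z.re) :
    ∃ θ : ℝ, |θ| ≤ a ∧ z = Complex.exp (θ * Complex.I) := by
  refine ⟨z.arg, ?_, ?_⟩
  · by_contra! hlt
    have h1 := Real.cos_lt_cos_of_nonneg_of_le_pi ha (Complex.abs_arg_le_pi z) hlt
    rw [Real.cos_abs, Complex.cos_arg (by intro h0; simp [h0] at hz), hz, div_one] at h1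
    linarith
  · have := Complex.norm_mul_exp_arg_mul_I z
    rw [hz] at this
    simpa using this.symm

/-- For real `v = t` numerator and denominator have equal modulus, and the real part of the quotient
exceeds `cos a` by `2 t sin² a / |α + t|²`. -/
theorem arcMobius_ofReal_mem_arc {a : ℝ} (ha : 0 < a) (ha' : a < Real.pi) {t : ℝ} (ht : 0 ≤ t) :
    ∃ θ : ℝ, |θ| ≤ a ∧
      arcMobius (Complex.exp (a * Complex.I)) t = Complex.exp (θ * Complex.I) := by
  have hs : 0 < Real.sin a := Real.sin_pos_of_pos_of_lt_pi ha ha'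
  have hcs := Real.sin_sq_add_cos_sq a
  have hE : Complex.exp (a * Complex.I) = ⟨Real.cos a, Real.sin a⟩ := by
    apply Complex.ext
    · exact Complex.exp_ofReal_mul_I_re a
    · exact Complex.exp_ofReal_mul_I_im a
  have hα : 0 < (Complex.exp (a * Complex.I)).im := by rw [hE]; exact hs
  have hne := arcMobius_denom_ne_zero hα (v := (t : ℂ)) (by simp)
  apply exists_angle_of_cos_le_re ha.le
  · rw [arcMobius, norm_div, div_eq_one_iff_eq (norm_ne_zero_iff.mpr hne)]
    refine (sq_eq_sq₀ (norm_nonneg _) (norm_nonneg _)).mp ?_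
    rw [← Complex.normSq_eq_norm_sq, ← Complex.normSq_eq_norm_sq, Complex.normSq_apply,
      Complex.normSq_apply, hE]
    simp
    linear_combination (t ^ 2 - 1) * hcs
  · have hD : Complex.normSq (Complex.exp (a * Complex.I) + t) =
        1 + t ^ 2 + 2 * t * Real.cos a := by
      rw [Complex.normSq_apply, hE]; simp; nlinarith
    have hDpos : 0 < 1 + t ^ 2 + 2 * t * Real.cos a := by
      rw [← hD]; exact Complex.normSq_pos.mpr hne
    rw [arcMobius, Complex.div_re, hD, ← add_div, le_div_iff₀ hDpos, hE]
    simp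
    have h4 : 0 ≤ t * Real.sin a ^ 2 := by positivity
    nlinarith

/-- The two-constants theorem for the unit disc and a short arc around `1`. -/
theorem norm_le_of_norm_le_on_arc {F : ℂ → ℂ} {R a B μ : ℝ} (hR : 1 < R)
    (hF : DifferentiableOn ℂ F (Metric.ball 0 R)) (ha : 0 < a) (ha1 : a ≤ 1)
    (hB : ∀ z, ‖z‖ ≤ 1 → ‖F z‖ ≤ B) (hB1 : 1 ≤ B) (hμ : 0 < μ) (hμ1 : μ ≤ 1)
    (harc : ∀ θ : ℝ, |θ| ≤ a → ‖F (Complex.exp (θ * Complex.I))‖ ≤ μ)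
    {z : ℂ} (hz : ‖z‖ ≤ 1) (hz1 : ‖z - 1‖ ≤ a / 6) :
    ‖F z‖ ≤ μ ^ (1 / 2 : ℝ) * B := by
  have hpi := Real.pi_gt_three
  have haπ : a < Real.pi := by linarith
  set α : ℂ := Complex.exp (a * Complex.I) with hαdef
  have hα1 : ‖α‖ = 1 := Complex.norm_exp_ofReal_mul_I a
  have hα : 0 < α.im := by
    rw [hαdef, Complex.exp_ofReal_mul_I_im]; exact Real.sin_pos_of_pos_of_lt_pi ha haπ
  have hαd : a / 2 ≤ ‖α - 1‖ := by
    rw [hαdef, mul_comm, Complex.norm_exp_I_mul_ofReal_sub_one, Real.norm_eq_abs]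
    have h1 : 2 / Real.pi * |a / 2| ≤ |Real.sin (a / 2)| :=
      Real.mul_abs_le_abs_sin (by rw [abs_of_pos (by positivity)]; linarith)
    rw [abs_of_pos (by positivity : 0 < a / 2)] at h1
    have h2 : (1 : ℝ) / 2 ≤ 2 / Real.pi := by
      rw [div_le_div_iff₀ (by norm_num) Real.pi_pos]; linarith [Real.pi_le_four]
    rw [abs_mul, abs_two]
    nlinarith
  have hαz : α - z ≠ 0 := by
    intro h
    have : ‖α - 1‖ = ‖z - 1‖ := by rw [sub_eq_zero.mp h]
    linarith
  -- the preimage of `z` under the Möbius transformation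
  set v : ℂ := (α * z - 1) / (α - z) with hv
  -- The radius `a / 6` is chosen here: `|α - z| ≥ a/2 - a/6 = a/3`, while `|α + 1| |z - 1| ≤ 2 ·
  -- a/6`. Hence `v` has nonnegative real part and `arg v ≤ π/2`, which produces the exponent `1/2`.
  have hv1 : ‖v - 1‖ ≤ 1 := by
    have h1 : v - 1 = (α + 1) * (z - 1) / (α - z) := by
      rw [hv]; field_simp; ring
    have h2 : ‖α - 1‖ - ‖z - 1‖ ≤ ‖α - z‖ := by
      have := norm_sub_norm_le (α - 1) (z - 1); simpa using this
    have h3 : ‖α + 1‖ ≤ 2 := by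
      refine (norm_add_le _ _).trans ?_; rw [hα1]; norm_num
    rw [h1, norm_div, norm_mul, div_le_one (norm_pos_iff.mpr hαz)]
    nlinarith [norm_nonneg (z - 1)]
  have hvre : 0 ≤ v.re := by
    have := (Complex.abs_re_le_norm (v - 1)).trans hv1
    rw [Complex.sub_re, Complex.one_re, abs_le] at this
    linarith
  have hα2 : α.re * α.re + α.im * α.im = 1 := by
    rw [← Complex.normSq_apply, Complex.normSq_eq_norm_sq, hα1]; norm_num
  have hvim : 0 ≤ v.im := by
    rw [hv, Complex.div_im, ← sub_div]
    refine div_nonneg ?_ (Complex.normSq_nonneg _)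
    have hz2 : z.re * z.re + z.im * z.im ≤ 1 := by
      rw [← Complex.normSq_apply, Complex.normSq_eq_norm_sq]; nlinarith [norm_nonneg z]
    simp
    have h5 : 0 ≤ α.im * (1 - (z.re * z.re + z.im * z.im)) := mul_nonneg hα.le (by linarith)
    have h6 : z.im * (α.re * α.re + α.im * α.im) = z.im := by rw [hα2, mul_one]
    nlinarith
  have hα0 : α ≠ 0 := by rw [← norm_ne_zero_iff, hα1]; norm_num
  have hαsq : α * α - 1 ≠ 0 := by
    intro h
    have h2 : (α * α - 1).re = 0 := by rw [h]; rfl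
    simp at h2
    nlinarith
  have hzv : arcMobius α v = z := by
    have hd := arcMobius_denom_ne_zero hα hvim
    rw [arcMobius, div_eq_iff hd, hv]
    field_simp
    ring
  -- `v = 0` has no logarithm; it corresponds to the endpoint `α⁻¹` of the arc, where the bound is
  -- immediate.
  by_cases hv0 : v = 0
  · have := arcMobius_ofReal_mem_arc ha haπ (le_refl (0 : ℝ))
    obtain ⟨θ, hθ, h⟩ := this
    rw [← hzv, hv0, ← Complex.ofReal_zero, hαdef, h]
    refine (harc θ hθ).trans ?_
    calc μ = μ ^ (1 : ℝ) := (Real.rpow_one μ).symm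
      _ ≤ μ ^ (1 / 2 : ℝ) := Real.rpow_le_rpow_of_exponent_ge hμ hμ1 (by norm_num)
      _ ≤ μ ^ (1 / 2 : ℝ) * B := le_mul_of_one_le_right (by positivity) hB1
  -- pass to the strip
  set f : ℂ → ℂ := fun s => F (arcMobius α (Complex.exp (Real.pi * Complex.I * s))) with hf
  have him : ∀ s : ℂ, (Real.pi * Complex.I * s).im = Real.pi * s.re := by intro s; simp
  have hexpim : ∀ s : ℂ, 0 ≤ s.re → s.re ≤ 1 →
      0 ≤ (Complex.exp (Real.pi * Complex.I * s)).im := by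
    intro s h0 h1
    rw [Complex.exp_im, him]
    have := Real.sin_nonneg_of_nonneg_of_le_pi (x := Real.pi * s.re) (by positivity)
      (by nlinarith)
    positivity
  have hdiff : ∀ s : ℂ, 0 ≤ s.re → s.re ≤ 1 → DifferentiableAt ℂ f s := by
    intro s h0 h1
    have hd := arcMobius_denom_ne_zero hα (hexpim s h0 h1)
    have hF' : DifferentiableAt ℂ F (arcMobius α (Complex.exp (Real.pi * Complex.I * s))) := by
      refine hF.differentiableAt (Metric.isOpen_ball.mem_nhds ?_)
      rw [mem_ball_zero_iff]
      exact (norm_arcMobius_le_one hα1 hα (hexpim s h0 h1)).trans_lt hR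
    have hg : DifferentiableAt ℂ
        (fun s => arcMobius α (Complex.exp (Real.pi * Complex.I * s))) s := by
      unfold arcMobius
      exact DifferentiableAt.div (by fun_prop) (by fun_prop) hd
    exact hF'.comp s hg
  have hbd : ∀ s : ℂ, 0 ≤ s.re → s.re ≤ 1 → ‖f s‖ ≤ B := fun s h0 h1 =>
    hB _ (norm_arcMobius_le_one hα1 hα (hexpim s h0 h1))
  -- Under `s ↦ exp(πis)` the line `Re s = 0` goes to the positive half-line, hence to the small
  -- arc, and `Re s₀ = arg v / π ≤ 1/2`.
  set s₀ : ℂ := Complex.log v / (Real.pi * Complex.I) with hs₀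
  have hπ0 : (Real.pi : ℂ) * Complex.I ≠ 0 := by
    simp [Real.pi_ne_zero]
  have hs₀re : s₀.re = v.arg / Real.pi := by
    have h : Complex.log v = Real.pi * Complex.I * s₀ := by rw [hs₀]; field_simp
    have h2 := congrArg Complex.im h
    rw [him, Complex.log_im] at h2
    rw [h2]; field_simp
  have harg0 : 0 ≤ v.arg := Complex.arg_nonneg_iff.mpr hvim
  have harg1 : v.arg ≤ Real.pi / 2 :=
    (abs_le.mp (Complex.abs_arg_le_pi_div_two_iff.mpr hvre)).2
  have hr0 : 0 ≤ s₀.re := by rw [hs₀re]; positivity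
  have hr1 : s₀.re ≤ 1 / 2 := by rw [hs₀re, div_le_iff₀ Real.pi_pos]; linarith
  have hfs : f s₀ = F z := by
    have : Real.pi * Complex.I * s₀ = Complex.log v := by rw [hs₀]; field_simp
    rw [hf]; simp only; rw [this, Complex.exp_log hv0, hzv]
  have key := Complex.HadamardThreeLines.norm_le_interp_of_mem_verticalClosedStrip₀₁' f
    (z := s₀) (a := μ) (b := B) ⟨hr0, by linarith⟩ ?_ ?_ ?_ ?_
  · rw [hfs] at key
    refine key.trans ?_
    have hx1 : μ ^ (1 - s₀.re) ≤ μ ^ (1 / 2 : ℝ) :=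
      Real.rpow_le_rpow_of_exponent_ge hμ hμ1 (by linarith)
    have hx2 : B ^ s₀.re ≤ B := by
      calc B ^ s₀.re ≤ B ^ (1 : ℝ) := Real.rpow_le_rpow_of_exponent_le hB1 (by linarith)
        _ = B := Real.rpow_one B
    exact mul_le_mul hx1 hx2 (by positivity) (by positivity)
  · refine DifferentiableOn.diffContOnCl ?_
    intro s hs
    have hs' : s ∈ Complex.re ⁻¹' Set.Icc (0 : ℝ) 1 := by
      refine closure_minimal (fun w hw => ?_) (isClosed_Icc.preimage Complex.continuous_re) hs
      exact ⟨hw.1.le, hw.2.le⟩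
    exact (hdiff s hs'.1 hs'.2).differentiableWithinAt
  · refine ⟨B, ?_⟩
    rintro _ ⟨s, hs, rfl⟩
    exact hbd s hs.1 hs.2
  · intro s hs
    have hs0 : s.re = 0 := hs
    have h1 : Complex.exp (Real.pi * Complex.I * s) = (Real.exp (-(Real.pi * s.im)) : ℝ) := by
      rw [Complex.ofReal_exp]
      congr 1
      apply Complex.ext <;> simp [hs0]
    obtain ⟨θ, hθ, h⟩ := arcMobius_ofReal_mem_arc ha haπ (Real.exp_pos (-(Real.pi * s.im))).le
    simp only [hf]
    rw [h1, hαdef, h]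
    exact harc θ hθ
  · intro s hs
    have hs1 : s.re = 1 := hs
    exact hbd s (by linarith) hs1.le

/-! ### A self-map of the disc touching the circle only near `1` -/

/-- With `u = r e^{iψ}` the real part is `r (cos ψ (3 - log r) + ψ sin ψ)`, at least `r (cos² ψ +
sin² ψ)`. The logarithm supplies `ψ sin ψ`, which is needed in directions where `Re u` is negligible
against `|u|`. -/
theorem norm_le_re_mul_three_sub_log {u : ℂ} (hu : 0 < u.re) (hu3 : ‖u‖ ≤ 3) :
    ‖u‖ ≤ (u * (3 - Complex.log u)).re := by
  have hu0 : u ≠ 0 := by rintro rfl; simp at hu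
  have hpos : 0 < ‖u‖ := norm_pos_iff.mpr hu0
  set ψ := u.arg with hψ
  have hψ2 := abs_le.mp (Complex.abs_arg_le_pi_div_two_iff.mpr hu.le)
  have hc : 0 ≤ Real.cos ψ := Real.cos_nonneg_of_mem_Icc ⟨by linarith [hψ2.1], hψ2.2⟩
  have hre : u.re = ‖u‖ * Real.cos ψ := (Complex.norm_mul_cos_arg u).symm
  have him : u.im = ‖u‖ * Real.sin ψ := (Complex.norm_mul_sin_arg u).symm
  have hlog : Real.log ‖u‖ ≤ 2 := (Real.log_le_sub_one_of_pos hpos).trans (by linarith)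
  have hsin : Real.sin ψ ^ 2 ≤ ψ * Real.sin ψ := by
    rcases le_total 0 ψ with h | h
    · have h1 := Real.sin_le h
      have h2 := Real.sin_nonneg_of_nonneg_of_le_pi h (by linarith [hψ2.2, Real.pi_pos])
      nlinarith
    · have h1 := Real.le_sin h
      have h2 := Real.sin_nonpos_of_nonpos_of_neg_pi_le h (by linarith [hψ2.1, Real.pi_pos])
      nlinarith
  have hmain : (u * (3 - Complex.log u)).re =
      ‖u‖ * (Real.cos ψ * (3 - Real.log ‖u‖) + ψ * Real.sin ψ) := by
    simp [Complex.log_re, Complex.log_im]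
    rw [hre, him]
    ring
  rw [hmain]
  refine le_mul_of_one_le_right hpos.le ?_
  have h1 := Real.sin_sq_add_cos_sq ψ
  have h2 := Real.cos_le_one ψ
  nlinarith

theorem norm_mul_three_sub_log_le (u : ℂ) :
    ‖u * (3 - Complex.log u)‖ ≤ ‖u‖ * (7 + |Real.log ‖u‖|) := by
  rw [norm_mul]
  refine mul_le_mul_of_nonneg_left ?_ (norm_nonneg _)
  have h1 : ‖Complex.log u‖ ≤ |Real.log ‖u‖| + 4 := by
    refine (Complex.norm_le_abs_re_add_abs_im _).trans ?_
    rw [Complex.log_re, Complex.log_im]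
    linarith [Complex.abs_arg_le_pi u, Real.pi_le_four]
  calc ‖3 - Complex.log u‖ ≤ ‖(3 : ℂ)‖ + ‖Complex.log u‖ := norm_sub_le _ _
    _ ≤ 7 + |Real.log ‖u‖| := by
        rw [Complex.norm_ofNat]; linarith

/-- A self-map of the unit disc fixing `0` whose boundary values approach the unit circle only
near `1`, at a linear rate. -/
noncomputable def contactMap (ε : ℝ) (z : ℂ) : ℂ :=
  z * Complex.exp (-((1 + ε - z) * (3 - Complex.log (1 + ε - z))))

theorem one_add_sub_re_pos {ε : ℝ} {z : ℂ} (hz : ‖z‖ < 1 + ε) : 0 < (1 + ε - z : ℂ).re := by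
  have := Complex.re_le_norm z
  simp
  linarith

theorem differentiableOn_contactMap (ε : ℝ) :
    DifferentiableOn ℂ (contactMap ε) (Metric.ball 0 (1 + ε)) := by
  intro z hz
  rw [mem_ball_zero_iff] at hz
  have hlog : DifferentiableAt ℂ (fun z : ℂ => Complex.log (1 + ε - z)) z :=
    DifferentiableAt.clog (by fun_prop) (Or.inl (one_add_sub_re_pos hz))
  unfold contactMap
  exact (DifferentiableAt.mul (by fun_prop) (DifferentiableAt.cexp
    (DifferentiableAt.neg (DifferentiableAt.mul (by fun_prop)
      (DifferentiableAt.sub (by fun_prop) hlog))))).differentiableWithinAt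

section contact

variable {ε : ℝ} {z : ℂ}

theorem le_norm_one_add_sub (hz : ‖z‖ ≤ 1) : ε ≤ ‖(1 + ε - z : ℂ)‖ := by
  refine le_trans ?_ (Complex.re_le_norm _)
  have := (Complex.re_le_norm z).trans hz
  simp
  linarith

theorem norm_sub_one_le_norm_one_add_sub (hε : 0 ≤ ε) (hz : ‖z‖ ≤ 1) :
    ‖z - 1‖ ≤ ‖(1 + ε - z : ℂ)‖ := by
  have h := (Complex.re_le_norm z).trans hz
  refine (sq_le_sq₀ (norm_nonneg _) (norm_nonneg _)).mp ?_
  rw [← Complex.normSq_eq_norm_sq, ← Complex.normSq_eq_norm_sq, Complex.normSq_apply,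
    Complex.normSq_apply]
  simp
  nlinarith

theorem norm_contactMap_le (hε : 0 < ε) (hε1 : ε ≤ 1) (hz : ‖z‖ ≤ 1) :
    ‖contactMap ε z‖ ≤ Real.exp (-‖(1 + ε - z : ℂ)‖) := by
  have hu3 : ‖(1 + ε - z : ℂ)‖ ≤ 3 := by
    calc ‖(1 + ε - z : ℂ)‖ ≤ ‖(1 : ℂ)‖ + ‖(ε : ℂ)‖ + ‖z‖ :=
          (norm_sub_le _ _).trans (by gcongr; exact norm_add_le _ _)
      _ ≤ 3 := by
          rw [norm_one, Complex.norm_real, Real.norm_of_nonneg hε.le]; linarith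
  have := norm_le_re_mul_three_sub_log (one_add_sub_re_pos (by linarith : ‖z‖ < 1 + ε)) hu3
  rw [contactMap, norm_mul, Complex.norm_exp, Complex.neg_re]
  calc _ ≤ 1 * Real.exp (-((1 + ε - z : ℂ) * (3 - Complex.log (1 + ε - z))).re) := by gcongr
    _ ≤ _ := by rw [one_mul]; gcongr

theorem norm_contactMap_le_exp_neg (hε : 0 < ε) (hε1 : ε ≤ 1) (hz : ‖z‖ ≤ 1) :
    ‖contactMap ε z‖ ≤ Real.exp (-ε) :=
  (norm_contactMap_le hε hε1 hz).trans (Real.exp_le_exp.mpr (neg_le_neg (le_norm_one_add_sub hz)))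

theorem norm_contactMap_le_exp_neg_norm_sub_one (hε : 0 < ε) (hε1 : ε ≤ 1) (hz : ‖z‖ ≤ 1) :
    ‖contactMap ε z‖ ≤ Real.exp (-‖z - 1‖) :=
  (norm_contactMap_le hε hε1 hz).trans
    (Real.exp_le_exp.mpr (neg_le_neg (norm_sub_one_le_norm_one_add_sub hε.le hz)))

/-- The exponent is of size `|u|` up to a logarithm, where `u = 1 + ε - z`. So points near `1` stay
near `1` with only a logarithmic loss, inside the region covered by the two-constants estimate. -/
theorem norm_contactMap_sub_one_le {δ K : ℝ} (hz : ‖z‖ ≤ 1)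
    (hu : ‖(1 + ε - z : ℂ)‖ ≤ δ) (hK : 7 + |Real.log ‖(1 + ε - z : ℂ)‖| ≤ K)
    (hδ : δ * K ≤ 1) : ‖contactMap ε z - 1‖ ≤ ‖z - 1‖ + 2 * (δ * K) := by
  set Φ := (1 + ε - z : ℂ) * (3 - Complex.log (1 + ε - z)) with hΦ
  have hb : ‖Φ‖ ≤ δ * K := (norm_mul_three_sub_log_le _).trans
    (mul_le_mul hu hK (by positivity) ((norm_nonneg _).trans hu))
  have h1 : ‖Complex.exp (-Φ) - 1‖ ≤ 2 * ‖-Φ‖ :=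
    Complex.norm_exp_sub_one_le (by rw [norm_neg]; linarith)
  rw [norm_neg] at h1
  have h2 : contactMap ε z - 1 = (z - 1) + z * (Complex.exp (-Φ) - 1) := by
    rw [contactMap, ← hΦ]; ring
  rw [h2]
  refine (norm_add_le _ _).trans ?_
  rw [norm_mul]
  have : ‖z‖ * ‖Complex.exp (-Φ) - 1‖ ≤ 1 * ‖Complex.exp (-Φ) - 1‖ := by gcongr
  linarith

end contact

/-! ### Products and counting over regular polygons -/

/-- The vertices of the regular `m`-gon rotated by the angle `φ`. -/
noncomputable def gonVertex (m : ℕ) (φ : ℝ) (k : ℕ) : ℂ :=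
  Complex.exp (((φ + 2 * Real.pi * k / m : ℝ) : ℂ) * Complex.I)

theorem norm_gonVertex (m : ℕ) (φ : ℝ) (k : ℕ) : ‖gonVertex m φ k‖ = 1 :=
  Complex.norm_exp_ofReal_mul_I _

/-- Some rotation of the regular `m`-gon carries a large product of values of `g`. -/
theorem exists_one_le_prod_norm_gonVertex {g : ℂ → ℂ}
    (hg : DifferentiableOn ℂ g (Metric.closedBall 0 1)) (hg0 : g 0 = 1) (m : ℕ) :
    ∃ φ : ℝ, 1 ≤ ∏ k ∈ Finset.range m, ‖g (gonVertex m φ k)‖ := by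
  -- `G(0) = 1`, so `|G| ≥ 1` at a maximum point on the unit circle; its argument is the desired
  -- rotation.
  set G : ℂ → ℂ := fun z => ∏ k ∈ Finset.range m, g (gonVertex m 0 k * z) with hG
  have hGd : DifferentiableOn ℂ G (Metric.closedBall 0 1) := by
    refine DifferentiableOn.fun_finsetProd fun k _ => ?_
    refine hg.comp (by fun_prop) fun z hz => ?_
    rw [mem_closedBall_zero_iff] at hz ⊢
    rwa [norm_mul, norm_gonVertex, one_mul]
  have hcl : closure (Metric.ball (0 : ℂ) 1) = Metric.closedBall 0 1 :=
    closure_ball _ one_ne_zero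
  obtain ⟨z, hz, hmax⟩ := Complex.exists_mem_frontier_isMaxOn_norm
    (Metric.isBounded_ball (x := (0 : ℂ)) (r := 1)) ⟨0, by simp⟩
    (DifferentiableOn.diffContOnCl (f := G) (𝕜 := ℂ)
      (by rwa [hcl]))
  rw [frontier_ball _ one_ne_zero, mem_sphere_zero_iff_norm] at hz
  have h0 := hmax (show (0 : ℂ) ∈ closure (Metric.ball 0 1) from subset_closure (by simp))
  simp only [Set.mem_ofPred_eq, Function.comp_apply, hG, mul_zero, hg0, Finset.prod_const_one,
    norm_one, norm_prod] at h0
  refine ⟨z.arg, h0.trans_eq (Finset.prod_congr rfl fun k _ => ?_)⟩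
  have hzarg : z = Complex.exp (z.arg * Complex.I) := by
    have := Complex.norm_mul_exp_arg_mul_I z
    rw [hz] at this
    simpa using this.symm
  congr 2
  conv_lhs => rw [hzarg]
  rw [gonVertex, gonVertex, ← Complex.exp_add]
  congr 1
  push_cast
  ring

theorem exp_ofReal_mul_I_eq_of_eq_add {ψ ψ' : ℝ} {N : ℤ} (h : ψ = ψ' + 2 * Real.pi * N) :
    Complex.exp ((ψ : ℂ) * Complex.I) = Complex.exp ((ψ' : ℂ) * Complex.I) := by
  rw [Complex.exp_eq_exp_iff_exists_int]
  exact ⟨N, by rw [h]; push_cast; ring⟩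

theorem mul_abs_le_norm_exp_sub_one {ψ : ℝ} (h : |ψ| ≤ Real.pi) :
    2 / Real.pi * |ψ| ≤ ‖Complex.exp ((ψ : ℂ) * Complex.I) - 1‖ := by
  rw [mul_comm (ψ : ℂ), Complex.norm_exp_I_mul_ofReal_sub_one, Real.norm_eq_abs, abs_mul, abs_two]
  have h1 : 2 / Real.pi * |ψ / 2| ≤ |Real.sin (ψ / 2)| :=
    Real.mul_abs_le_abs_sin (by rw [abs_div, abs_two]; linarith)
  rw [abs_div, abs_two] at h1
  linarith

/-- Reduce the angle modulo `2π` to `[-π, π]`, where a chord is at least `2/π` times its angle; this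
replaces the index `k` by `k - mN`. -/
theorem exists_int_gonVertex {m : ℕ} (hm : 0 < m) (φ : ℝ) (k : ℕ) :
    ∃ N : ℤ, 2 / Real.pi * |φ + 2 * Real.pi * ((k - m * N : ℤ) : ℝ) / m| ≤
      ‖gonVertex m φ k - 1‖ := by
  have hpi := Real.pi_pos
  have hm' : (0 : ℝ) < m := by exact_mod_cast hm
  set ψ : ℝ := φ + 2 * Real.pi * k / m with hψ
  refine ⟨round (ψ / (2 * Real.pi)), ?_⟩
  set N := round (ψ / (2 * Real.pi)) with hN
  have hr : |ψ / (2 * Real.pi) - N| ≤ 1 / 2 := abs_sub_round _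
  have he : φ + 2 * Real.pi * ((k - m * N : ℤ) : ℝ) / m =
      2 * Real.pi * (ψ / (2 * Real.pi) - N) := by
    rw [hψ]; push_cast; field_simp; ring
  have hle : |φ + 2 * Real.pi * ((k - m * N : ℤ) : ℝ) / m| ≤ Real.pi := by
    rw [he, abs_mul, abs_of_pos (by positivity : 0 < 2 * Real.pi)]
    nlinarith
  have heq : gonVertex m φ k =
      Complex.exp (((φ + 2 * Real.pi * ((k - m * N : ℤ) : ℝ) / m : ℝ) : ℂ) * Complex.I) :=
    exp_ofReal_mul_I_eq_of_eq_add (N := N) (by rw [he, hψ]; field_simp; ring)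
  rw [heq]
  exact mul_abs_le_norm_exp_sub_one hle

/-- The reduced indices `k - mN` are integers in an interval of length `mτ/2`, and they are distinct
because they differ modulo `m`. -/
theorem card_filter_gonVertex_near_le {m : ℕ} (hm : 0 < m) (φ : ℝ) {τ : ℝ} (hτ : 0 ≤ τ) :
    (((Finset.range m).filter fun k => ‖gonVertex m φ k - 1‖ < τ).card : ℝ) ≤ m * τ / 2 + 1 := by
  have hpi := Real.pi_pos
  have hm' : (0 : ℝ) < m := by exact_mod_cast hm
  choose N hN using exists_int_gonVertex hm φ
  set A : ℝ := (-(Real.pi * τ / 2) - φ) * m / (2 * Real.pi) with hA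
  set B : ℝ := (Real.pi * τ / 2 - φ) * m / (2 * Real.pi) with hB
  have hBA : B - A = m * τ / 2 := by rw [hA, hB]; field_simp; ring
  have hcard : ((Finset.range m).filter fun k => ‖gonVertex m φ k - 1‖ < τ).card ≤
      (Finset.Icc ⌈A⌉ ⌊B⌋).card := by
    refine Finset.card_le_card_of_injOn (fun k => (k : ℤ) - m * N k) ?_ ?_
    · intro k hk
      have hk2 := (Finset.mem_filter.mp (Finset.mem_coe.mp hk)).2
      have h := (hN k).trans_lt hk2
      rw [← lt_div_iff₀' (by positivity), abs_lt] at h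
      have e : τ / (2 / Real.pi) = Real.pi * τ / 2 := by field_simp
      rw [e] at h
      have e2 : 2 * Real.pi * ((k - m * N k : ℤ) : ℝ) / m * (m / (2 * Real.pi)) =
          ((k - m * N k : ℤ) : ℝ) := by field_simp
      have hp : 0 < (m : ℝ) / (2 * Real.pi) := by positivity
      rw [Finset.mem_coe, Finset.mem_Icc, Int.ceil_le, Int.le_floor]
      constructor
      · rw [← e2, hA, mul_div_assoc (-(Real.pi * τ / 2) - φ)]
        exact mul_le_mul_of_nonneg_right (by linarith [h.1]) hp.le
      · rw [← e2, hB, mul_div_assoc (Real.pi * τ / 2 - φ)]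
        exact mul_le_mul_of_nonneg_right (by linarith [h.2]) hp.le
    · intro k hk k' hk' h
      simp only [Finset.coe_filter, Finset.mem_range, Set.mem_ofPred_eq] at hk hk'
      have h1 : ((k : ℤ) - m * N k) % m = ((k' : ℤ) - m * N k') % m := congrArg (· % (m : ℤ)) h
      rw [Int.sub_mul_emod_self_left, Int.sub_mul_emod_self_left,
        Int.emod_eq_of_lt (by positivity) (by exact_mod_cast hk.1),
        Int.emod_eq_of_lt (by positivity) (by exact_mod_cast hk'.1)] at h1
      exact_mod_cast h1
  rw [Int.card_Icc] at hcard
  refine (Nat.cast_le.mpr hcard).trans ?_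
  have h1 : ((⌊B⌋ + 1 - ⌈A⌉ : ℤ) : ℝ) ≤ m * τ / 2 + 1 := by
    push_cast
    linarith [Int.floor_le B, Int.le_ceil A]
  have h2 : (0 : ℝ) ≤ m * τ / 2 + 1 := by positivity
  rcases le_total 0 (⌊B⌋ + 1 - ⌈A⌉) with h | h
  · have : (((⌊B⌋ + 1 - ⌈A⌉).toNat : ℤ) : ℝ) = ((⌊B⌋ + 1 - ⌈A⌉ : ℤ) : ℝ) := by
      rw [Int.toNat_of_nonneg h]
    rw [Int.cast_natCast] at this
    rw [this]; exact h1
  · rw [Int.toNat_of_nonpos h]; simpa using h2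

theorem exists_gonVertex_near {m : ℕ} (hm : 0 < m) (φ : ℝ) :
    ∃ k < m, ‖gonVertex m φ k - 1‖ ≤ Real.pi / m := by
  have hpi := Real.pi_pos
  have hm' : (0 : ℝ) < m := by exact_mod_cast hm
  have hmz : (0 : ℤ) < m := by exact_mod_cast hm
  set j : ℤ := round (-φ * m / (2 * Real.pi)) with hj
  have hr : |-φ * m / (2 * Real.pi) - j| ≤ 1 / 2 := abs_sub_round _
  have hk0 : 0 ≤ j % m := Int.emod_nonneg _ hmz.ne'
  refine ⟨(j % m).toNat, (Int.toNat_lt hk0).mpr (Int.emod_lt_of_pos _ hmz), ?_⟩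
  have hkc : (((j % m).toNat : ℕ) : ℝ) = j - m * ((j / m : ℤ) : ℝ) := by
    have h1 : (((j % m).toNat : ℤ) : ℝ) = ((j - m * (j / m) : ℤ) : ℝ) := by
      rw [Int.toNat_of_nonneg hk0, Int.emod_def]
    rw [Int.cast_natCast] at h1
    rw [h1]; push_cast; ring
  have heq : gonVertex m φ (j % m).toNat =
      Complex.exp (((φ + 2 * Real.pi * j / m : ℝ) : ℂ) * Complex.I) := by
    refine exp_ofReal_mul_I_eq_of_eq_add (N := -(j / m)) ?_
    rw [hkc]; push_cast; field_simp; ring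
  rw [heq, mul_comm]
  refine Real.norm_exp_I_mul_ofReal_sub_one_le.trans ?_
  have e : φ + 2 * Real.pi * j / m = -(-φ * m / (2 * Real.pi) - j) * (2 * Real.pi / m) := by
    field_simp; ring
  rw [Real.norm_eq_abs, e, abs_mul, abs_neg, abs_of_pos (by positivity : 0 < 2 * Real.pi / m)]
  calc _ ≤ 1 / 2 * (2 * Real.pi / m) := by gcongr
    _ = Real.pi / m := by ring

/-- If a holomorphic function with value `1` at the centre is very small near `1`, then it cannot
be of moderate size near `1` and hardly larger than `1` elsewhere on the unit circle. -/
theorem le_of_norm_le_near_one {g : ℂ → ℂ} {A M τ : ℝ} {m : ℕ}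
    (hg : DifferentiableOn ℂ g (Metric.closedBall 0 1)) (hg0 : g 0 = 1) (hm : 0 < m) (hA : 0 ≤ A)
    (hτ : 0 ≤ τ) (hbd : ∀ z, ‖z‖ ≤ 1 → ‖g z‖ ≤ Real.exp A)
    (hfar : ∀ z, ‖z‖ ≤ 1 → τ ≤ ‖z - 1‖ → ‖g z‖ ≤ Real.exp (1 / m))
    (hnear : ∀ z, ‖z‖ ≤ 1 → ‖z - 1‖ ≤ Real.pi / m → ‖g z‖ ≤ Real.exp (A - M)) :
    M ≤ 1 + 2 * A + A * (m * τ / 2) := by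
  have hm' : (0 : ℝ) < m := by exact_mod_cast hm
  obtain ⟨φ, hφ⟩ := exists_one_le_prod_norm_gonVertex hg hg0 m
  obtain ⟨k₀, hk₀, hk₀1⟩ := exists_gonVertex_near hm φ
  have hcard := card_filter_gonVertex_near_le hm φ hτ
  -- The far-field terms `1/m` add up to `1`. The vertex `k₀` may also be charged `A` for lying
  -- within `τ`, which is harmless since `A ≥ 0`.
  set c : ℕ → ℝ := fun k => 1 / m + (if ‖gonVertex m φ k - 1‖ < τ then A else 0) +
    (if k = k₀ then A - M else 0) with hc
  have hle : ∀ k ∈ Finset.range m, ‖g (gonVertex m φ k)‖ ≤ Real.exp (c k) := by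
    intro k _
    have h1 := (norm_gonVertex m φ k).le
    have hm1 : 0 ≤ 1 / (m : ℝ) := by positivity
    by_cases hk : k = k₀
    · have hn : 0 ≤ if ‖gonVertex m φ k - 1‖ < τ then A else 0 := by split_ifs <;> simp [hA]
      refine (hnear _ h1 (by rw [hk]; exact hk₀1)).trans (Real.exp_le_exp.mpr ?_)
      simp only [hc, if_pos hk]
      linarith
    · by_cases hn : ‖gonVertex m φ k - 1‖ < τ
      · refine (hbd _ h1).trans (Real.exp_le_exp.mpr ?_)
        simp only [hc, if_neg hk, if_pos hn]
        linarith
      · refine (hfar _ h1 (not_lt.mp hn)).trans (Real.exp_le_exp.mpr ?_)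
        simp only [hc, if_neg hk, if_neg hn]
        linarith
  have h2 : 1 ≤ Real.exp (∑ k ∈ Finset.range m, c k) := by
    rw [Real.exp_sum]
    exact hφ.trans (Finset.prod_le_prod (fun _ _ => norm_nonneg _) hle)
  have h3 := Real.one_le_exp_iff.mp h2
  have h4 : ∑ k ∈ Finset.range m, c k = 1 +
      ((Finset.range m).filter fun k => ‖gonVertex m φ k - 1‖ < τ).card * A + (A - M) := by
    simp only [hc, Finset.sum_add_distrib]
    congr 1
    · congr 1
      · simp [hm'.ne']
      · rw [← Finset.sum_filter, Finset.sum_const, nsmul_eq_mul]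
    · rw [Finset.sum_ite_eq' , if_pos (Finset.mem_range.mpr hk₀)]
  rw [h4] at h3
  nlinarith

/-! ### Gap series and their smallness on an arc -/

section powerSeries

variable {e : ℕ → ℂ} {c : ℝ} {L : ℕ}

theorem summable_norm_mul_pow_of_norm_le (hb : ∀ j, ‖e j‖ ≤ c) {z : ℂ} (hz : ‖z‖ < 1) :
    Summable fun j => ‖e j * z ^ j‖ := by
  refine Summable.of_nonneg_of_le (fun _ => norm_nonneg _) (fun j => ?_)
    ((summable_geometric_of_lt_one (norm_nonneg z) hz).mul_left c)
  rw [norm_mul, norm_pow]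
  gcongr
  exact hb j

theorem norm_tsum_mul_pow_le (h0 : ∀ j < L, e j = 0) (hb : ∀ j, ‖e j‖ ≤ c) {z : ℂ}
    (hz : ‖z‖ < 1) : ‖∑' j, e j * z ^ j‖ ≤ c * ‖z‖ ^ L / (1 - ‖z‖) := by
  have hs := summable_norm_mul_pow_of_norm_le hb hz
  have h1 : ∑' j, e j * z ^ j = ∑' j, e (j + L) * z ^ (j + L) := by
    rw [← hs.of_norm.sum_add_tsum_nat_add L, Finset.sum_eq_zero, zero_add]
    intro j hj
    rw [h0 j (Finset.mem_range.mp hj), zero_mul]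
  rw [h1]
  refine tsum_of_norm_bounded (g := fun j => c * ‖z‖ ^ L * ‖z‖ ^ j)
    ((hasSum_geometric_of_lt_one (norm_nonneg z) hz).mul_left (c * ‖z‖ ^ L)) fun j => ?_
  rw [norm_mul, norm_pow, pow_add, mul_comm (‖z‖ ^ j), ← mul_assoc]
  gcongr
  exact hb _

theorem differentiableOn_tsum_mul_pow (hb : ∀ j, ‖e j‖ ≤ c) :
    DifferentiableOn ℂ (fun z => ∑' j, e j * z ^ j) (Metric.ball 0 1) := by
  intro z hz
  rw [mem_ball_zero_iff] at hz
  obtain ⟨r, hr, hr1⟩ := exists_between hz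
  have hr0 : 0 ≤ r := (norm_nonneg z).trans hr.le
  have hd : DifferentiableOn ℂ (fun z => ∑' j, e j * z ^ j) (Metric.ball 0 r) := by
    refine Complex.differentiableOn_tsum_of_summable_norm
      ((summable_geometric_of_lt_one hr0 hr1).mul_left c) (fun j => by fun_prop)
      Metric.isOpen_ball fun j w hw => ?_
    rw [mem_ball_zero_iff] at hw
    rw [norm_mul, norm_pow]
    have := (norm_nonneg _).trans (hb j)
    gcongr
    exact hb j
  exact (hd.differentiableAt (Metric.isOpen_ball.mem_nhds
    (by rwa [mem_ball_zero_iff]))).differentiableWithinAt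

end powerSeries

/-- The power series `1 - η z ^ d + ∑ e j z ^ j`. -/
noncomputable def gapSeries (η : ℂ) (d : ℕ) (e : ℕ → ℂ) (z : ℂ) : ℂ :=
  1 - η * z ^ d + ∑' j, e j * z ^ j

section gapSeries

variable {η : ℂ} {d L : ℕ} {e : ℕ → ℂ}

theorem differentiableOn_gapSeries (hb : ∀ j, ‖e j‖ ≤ 2) :
    DifferentiableOn ℂ (gapSeries η d e) (Metric.ball 0 1) := by
  have := differentiableOn_tsum_mul_pow hb
  unfold gapSeries
  exact DifferentiableOn.add (by fun_prop) this

theorem norm_mul_pow_le_norm (hη : ‖η‖ ≤ 1) (hd : 1 ≤ d) {z : ℂ} (hz : ‖z‖ ≤ 1) :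
    ‖η * z ^ d‖ ≤ ‖z‖ := by
  rw [norm_mul, norm_pow]
  calc ‖η‖ * ‖z‖ ^ d ≤ 1 * ‖z‖ ^ 1 :=
        mul_le_mul hη (pow_le_pow_of_le_one (norm_nonneg z) hz hd) (by positivity) zero_le_one
    _ = ‖z‖ := by ring

theorem one_sub_norm_le_norm_one_sub_mul_pow (hη : ‖η‖ ≤ 1) (hd : 1 ≤ d) {z : ℂ} (hz : ‖z‖ ≤ 1) :
    1 - ‖z‖ ≤ ‖1 - η * z ^ d‖ := by
  have h1 := norm_mul_pow_le_norm hη hd hz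
  have h2 := norm_sub_norm_le 1 (η * z ^ d)
  rw [norm_one] at h2
  linarith

theorem norm_gapSeries_le (hη : ‖η‖ ≤ 1) (hd : 1 ≤ d) (hb : ∀ j, ‖e j‖ ≤ 2) {z : ℂ}
    (hz : ‖z‖ < 1) : ‖gapSeries η d e z‖ ≤ 2 + 2 / (1 - ‖z‖) := by
  have h1 := norm_mul_pow_le_norm hη hd hz.le
  have h2 := norm_tsum_mul_pow_le (L := 0) (by simp) hb hz
  rw [pow_zero, mul_one] at h2
  calc ‖gapSeries η d e z‖ ≤ ‖(1 : ℂ)‖ + ‖η * z ^ d‖ + ‖∑' j, e j * z ^ j‖ :=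
        (norm_add_le _ _).trans (by gcongr; exact norm_sub_le _ _)
    _ ≤ _ := by rw [norm_one]; linarith

theorem gapSeries_zero (hd : 1 ≤ d) (hL : 1 ≤ L) (h0 : ∀ j < L, e j = 0) :
    gapSeries η d e 0 = 1 := by
  have h1 : ∀ j, e j * (0 : ℂ) ^ j = 0 := by
    intro j
    rcases Nat.eq_zero_or_pos j with rfl | hj
    · rw [h0 0 (by omega), zero_mul]
    · rw [zero_pow (by omega), mul_zero]
  rw [gapSeries, tsum_congr h1, tsum_zero, zero_pow (by omega)]
  ring

/-- A gap series that is at most `exp (-2M)` on a short arc: a bound for `M`. -/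
theorem le_of_norm_gapSeries_le_on_arc {n m : ℕ} {ρ a τ M : ℝ} (hn : 16 ≤ n) (hm : 0 < m)
    (hρ : 0 < ρ) (hρ1 : ρ ≤ 1 - 1 / n) (ha : 0 < a) (ha1 : a ≤ 1) (hτ : 0 ≤ τ) (hM : 0 ≤ M)
    (hη : ‖η‖ ≤ 1) (hd : 1 ≤ d) (hL : 1 ≤ L) (h0 : ∀ j < L, e j = 0) (hb : ∀ j, ‖e j‖ ≤ 2)
    (hτL : 8 * (n : ℝ) ^ 2 * m ≤ Real.exp (τ * L))
    (hm1 : (Real.pi / m + 1 / n) * (7 + Real.log n) ≤ 1)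
    (hma : Real.pi / m + 2 * ((Real.pi / m + 1 / n) * (7 + Real.log n)) ≤ a / 6)
    (harc : ∀ θ : ℝ, |θ| ≤ a →
      ‖gapSeries η d e (ρ * Complex.exp (θ * Complex.I))‖ ≤ Real.exp (-(2 * M))) :
    M ≤ 1 + 8 * Real.log n + 2 * Real.log n * (m * τ) := by
  have hn' : (16 : ℝ) ≤ n := by exact_mod_cast hn
  have hn0 : (0 : ℝ) < n := by linarith
  have hm' : (0 : ℝ) < m := by exact_mod_cast hm
  have hT : 0 ≤ Real.log n := Real.log_nonneg (by linarith)
  have hinv : 1 / (n : ℝ) ≤ 1 / 16 := one_div_le_one_div_of_le (by norm_num) hn'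
  have hinv0 : 0 < 1 / (n : ℝ) := by positivity
  have hexpT : Real.exp (4 * Real.log n) = (n : ℝ) ^ 4 := by
    rw [show (4 : ℝ) * Real.log n = ((4 : ℕ) : ℝ) * Real.log n by norm_num, Real.exp_nat_mul,
      Real.exp_log hn0]
  set h := contactMap (1 / n) with hh
  set Fρ : ℂ → ℂ := fun z => gapSeries η d e (ρ * z) with hFρ
  have hρn : ∀ z : ℂ, ‖(ρ : ℂ) * z‖ = ρ * ‖z‖ := fun z => by
    rw [norm_mul, Complex.norm_real, Real.norm_of_nonneg hρ.le]
  have hρz : ∀ z : ℂ, ‖(ρ : ℂ) * z‖ ≤ ‖z‖ := fun z => by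
    rw [hρn]; exact mul_le_of_le_one_left (norm_nonneg z) (by linarith)
  have hFd : DifferentiableOn ℂ Fρ (Metric.ball 0 (1 / ρ)) := by
    refine (differentiableOn_gapSeries hb).comp (by fun_prop) fun z hz => ?_
    rw [mem_ball_zero_iff] at hz ⊢
    rw [hρn]
    calc ρ * ‖z‖ < ρ * (1 / ρ) := by gcongr
      _ = 1 := by field_simp
  have hR : 1 < 1 / ρ := by rw [lt_div_iff₀ hρ]; linarith
  have hFB : ∀ z, ‖z‖ ≤ 1 → ‖Fρ z‖ ≤ (n : ℝ) ^ 2 := by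
    intro z hz
    have h1 : ‖(ρ : ℂ) * z‖ ≤ 1 - 1 / n := by
      rw [hρn]; nlinarith [norm_nonneg z]
    refine (norm_gapSeries_le hη hd hb (by linarith)).trans ?_
    calc 2 + 2 / (1 - ‖(ρ : ℂ) * z‖) ≤ 2 + 2 / (1 / n) := by gcongr; linarith
      _ = 2 + 2 * n := by field_simp
      _ ≤ (n : ℝ) ^ 2 := by nlinarith
  have hδ : ∀ z, ‖z‖ ≤ 1 → ‖h z‖ ≤ 1 - 1 / (2 * n) := by
    intro z hz
    refine (norm_contactMap_le_exp_neg hinv0 (by linarith) hz).trans ?_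
    have h1 := Real.one_sub_inv_le_log_of_pos (x := 1 - 1 / (2 * (n : ℝ))) (by
      have : 1 / (2 * (n : ℝ)) = 1 / n / 2 := by field_simp
      linarith)
    have h2 : -(1 / (n : ℝ)) ≤ 1 - (1 - 1 / (2 * (n : ℝ)))⁻¹ := by
      have h3 : 1 - 1 / (2 * (n : ℝ)) = (2 * n - 1) / (2 * n) := by field_simp
      rw [h3, inv_div, neg_le_sub_iff_le_add, div_le_iff₀ (by linarith)]
      field_simp
      nlinarith
    have h4 : 0 < 1 - 1 / (2 * (n : ℝ)) := by
      have : 1 / (2 * (n : ℝ)) = 1 / n / 2 := by field_simp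
      linarith
    calc Real.exp (-(1 / (n : ℝ))) ≤ Real.exp (Real.log (1 - 1 / (2 * (n : ℝ)))) :=
          Real.exp_le_exp.mpr (h2.trans h1)
      _ = _ := Real.exp_log h4
  have h2n : 0 < 1 / (2 * (n : ℝ)) := by positivity
  have hh1 : ∀ z, ‖z‖ ≤ 1 → ‖h z‖ ≤ 1 := fun z hz => (hδ z hz).trans (by linarith)
  have hden : ∀ z, ‖z‖ ≤ 1 → 1 / (2 * (n : ℝ)) ≤ ‖1 - η * (ρ * h z) ^ d‖ := by
    intro z hz
    have h1 := hδ z hz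
    have h2 := hρz (h z)
    have h3 := one_sub_norm_le_norm_one_sub_mul_pow hη hd (z := ρ * h z) (by linarith)
    linarith
  have hden0 : ∀ z, ‖z‖ ≤ 1 → 1 - η * (ρ * h z) ^ d ≠ 0 := fun z hz =>
    norm_pos_iff.mp (h2n.trans_le (hden z hz))
  have hquot : ∀ z, ‖z‖ ≤ 1 → ∀ w : ℂ, ‖w / (1 - η * (ρ * h z) ^ d)‖ ≤ ‖w‖ * (2 * n) := by
    intro z hz w
    rw [norm_div, div_le_iff₀ (h2n.trans_le (hden z hz))]
    calc ‖w‖ = ‖w‖ * (2 * n) * (1 / (2 * n)) := by field_simp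
      _ ≤ _ := by gcongr; exact hden z hz
  -- Division cancels the low-degree part, leaving `1` plus a tail of order `L`, at the cost of a
  -- factor `2n`.
  set g : ℂ → ℂ := fun z => Fρ (h z) / (1 - η * (ρ * h z) ^ d) with hg
  have hconst : 2 * (n : ℝ) * n ^ 2 ≤ Real.exp (4 * Real.log n) := by
    rw [hexpT]
    have : (n : ℝ) ^ 4 = n * (n * n ^ 2) := by ring
    rw [this, mul_assoc]
    gcongr
    linarith
  have key := le_of_norm_le_near_one (g := g) (A := 4 * Real.log n) (M := M) (τ := τ) (m := m)
    ?_ ?_ hm (by positivity) hτ ?_ ?_ ?_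
  · linarith
  · intro z hz
    rw [mem_closedBall_zero_iff] at hz
    have hhd : DifferentiableAt ℂ h z :=
      (differentiableOn_contactMap (1 / n)).differentiableAt (Metric.isOpen_ball.mem_nhds
        (by rw [mem_ball_zero_iff]; linarith))
    have hFz : DifferentiableAt ℂ Fρ (h z) :=
      hFd.differentiableAt (Metric.isOpen_ball.mem_nhds
        (by rw [mem_ball_zero_iff]; linarith [hh1 z hz]))
    have h1 : DifferentiableAt ℂ (fun z => Fρ (h z)) z := hFz.comp z hhd
    exact (h1.div (by fun_prop) (hden0 z hz)).differentiableWithinAt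
  · have h1 : h 0 = 0 := by simp [hh, contactMap]
    simp only [hg, h1, hFρ, mul_zero]
    rw [gapSeries_zero hd hL h0, zero_pow (by omega)]
    simp
  · intro z hz
    refine (hquot z hz _).trans (le_trans ?_ hconst)
    rw [mul_comm]
    gcongr
    exact hFB _ (hh1 z hz)
  · intro z hz hzτ
    -- Here `|h z| ≤ exp(-τ)`, so a tail starting at degree `L` gains `exp(-τL)`; this beats `8 n²
    -- m`.
    have hE : ‖∑' j, e j * (ρ * h z) ^ j‖ ≤ Real.exp (-(τ * L)) * (4 * n) := by
      have h1 := hδ z hz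
      have h2 := hρz (h z)
      refine (norm_tsum_mul_pow_le h0 hb (z := ρ * h z) (by linarith)).trans ?_
      have h3 : ‖(ρ : ℂ) * h z‖ ^ L ≤ Real.exp (-(τ * L)) := by
        calc ‖(ρ : ℂ) * h z‖ ^ L ≤ Real.exp (-τ) ^ L := by
              gcongr
              refine h2.trans ((norm_contactMap_le_exp_neg_norm_sub_one hinv0 (by linarith)
                hz).trans (Real.exp_le_exp.mpr (by linarith)))
          _ = Real.exp (-(τ * L)) := by rw [← Real.exp_nat_mul]; congr 1; ring
      calc 2 * ‖(ρ : ℂ) * h z‖ ^ L / (1 - ‖(ρ : ℂ) * h z‖)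
          ≤ 2 * Real.exp (-(τ * L)) / (1 / (2 * n)) := by gcongr; linarith
        _ = Real.exp (-(τ * L)) * (4 * n) := by field_simp; ring
    have hgz : g z = 1 + (∑' j, e j * (ρ * h z) ^ j) / (1 - η * (ρ * h z) ^ d) := by
      simp only [hg, hFρ, gapSeries]
      rw [add_div, div_self (hden0 z hz)]
    rw [hgz]
    refine (norm_add_le _ _).trans ?_
    have h5 : ‖(∑' j, e j * (ρ * h z) ^ j) / (1 - η * (ρ * h z) ^ d)‖ ≤ 1 / m := by
      refine (hquot z hz _).trans ?_
      rw [le_div_iff₀ hm']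
      calc ‖∑' j, e j * (ρ * h z) ^ j‖ * (2 * n) * m
          ≤ Real.exp (-(τ * L)) * (4 * n) * (2 * n) * m := by gcongr
        _ = Real.exp (-(τ * L)) * (8 * n ^ 2 * m) := by ring
        _ ≤ Real.exp (-(τ * L)) * Real.exp (τ * L) := by gcongr
        _ = 1 := by rw [← Real.exp_add]; simp
    rw [norm_one]
    linarith [Real.add_one_le_exp (1 / (m : ℝ))]
  · intro z hz hzm
    have hu : ‖(1 + (1 / n : ℝ) - z : ℂ)‖ ≤ Real.pi / m + 1 / n := by
      have h1 : (1 + (1 / n : ℝ) - z : ℂ) = -(z - 1) + (1 / n : ℝ) := by ring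
      rw [h1]
      refine (norm_add_le _ _).trans ?_
      rw [norm_neg, Complex.norm_real, Real.norm_of_nonneg hinv0.le]
      gcongr
    have hu1 : 1 / (n : ℝ) ≤ ‖(1 + (1 / n : ℝ) - z : ℂ)‖ := le_norm_one_add_sub hz
    have hlog : |Real.log ‖(1 + (1 / n : ℝ) - z : ℂ)‖| ≤ Real.log n := by
      rw [abs_le]
      constructor
      · have := Real.log_le_log hinv0 hu1
        have hl : Real.log (1 / (n : ℝ)) = -Real.log n := by rw [one_div, Real.log_inv]
        linarith
      · refine Real.log_le_log (hinv0.trans_le hu1) (hu.trans ?_)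
        have : Real.pi / m + 1 / n ≤ 1 := by
          refine le_trans ?_ hm1
          exact le_mul_of_one_le_right (by positivity) (by linarith)
        linarith
    -- `h z` lies where the two-constants estimate applies; its square root turns `exp(-2M)` into
    -- `exp(-M)`.
    have h1 : ‖h z - 1‖ ≤ a / 6 :=
      (norm_contactMap_sub_one_le hz hu (by linarith) hm1).trans (by linarith)
    have h2 := norm_le_of_norm_le_on_arc hR hFd ha ha1 hFB (by nlinarith)
      (Real.exp_pos (-(2 * M))) (Real.exp_le_one_iff.mpr (by linarith)) harc (hh1 z hz) h1
    rw [← Real.exp_mul, show -(2 * M) * (1 / 2) = -M by ring] at h2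
    calc ‖g z‖ ≤ ‖Fρ (h z)‖ * (2 * n) := hquot z hz _
      _ ≤ Real.exp (-M) * n ^ 2 * (2 * n) := by gcongr
      _ = Real.exp (-M) * (2 * n * n ^ 2) := by ring
      _ ≤ Real.exp (-M) * Real.exp (4 * Real.log n) := by gcongr
      _ = Real.exp (4 * Real.log n - M) := by rw [← Real.exp_add]; congr 1; ring

end gapSeries

/-! ### Choice of parameters -/

/-- The exponents come from the second-order error in `n log ρ`: `n (n^(-4/5) log^6 n)² = log^12 n /
n^(3/5)`. -/
theorem eventually_log_pow_le_rpow :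
    ∀ᶠ n : ℕ in Filter.atTop, 7 ≤ Real.log n ∧ 1000 * Real.log n ^ 12 ≤ (n : ℝ) ^ (3 / 5 : ℝ) := by
  have h1 := tendsto_natCast_atTop_atTop (R := ℝ)
  have h2 := (Real.tendsto_log_atTop.comp h1).eventually_ge_atTop 7
  have h3 := (isLittleO_log_rpow_rpow_atTop (s := 3 / 5) 12 (by norm_num)).bound
    (c := 1 / 1000) (by norm_num)
  filter_upwards [h2, h1.eventually h3] with n hn hb
  simp only [Function.comp_apply] at hn
  refine ⟨hn, ?_⟩
  rw [show (12 : ℝ) = ((12 : ℕ) : ℝ) by norm_num, Real.rpow_natCast,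
    Real.norm_of_nonneg (by positivity), Real.norm_of_nonneg (by positivity)] at hb
  linarith

/-- The quantities of the main theorem in terms of `p = n ^ (1/5)`. -/
theorem exists_fifth_root {n : ℕ} (hn : 0 < n) : ∃ p : ℝ, 0 < p ∧ (n : ℝ) = p ^ 5 ∧
    (n : ℝ) ^ (1 / 5 : ℝ) = p ∧ (n : ℝ) ^ (3 / 5 : ℝ) = p ^ 3 ∧
    (n : ℝ) ^ (-(2 / 5) : ℝ) = 1 / p ^ 2 ∧ (n : ℝ) ^ (-(4 / 5) : ℝ) = 1 / p ^ 4 := by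
  have hn' : (0 : ℝ) < n := by exact_mod_cast hn
  have h : ∀ k : ℕ, ((n : ℝ) ^ (1 / 5 : ℝ)) ^ k = (n : ℝ) ^ ((k : ℝ) / 5) := by
    intro k
    rw [← Real.rpow_natCast, ← Real.rpow_mul hn'.le]
    congr 1
    ring
  refine ⟨(n : ℝ) ^ (1 / 5 : ℝ), by positivity, ?_, rfl, ?_, ?_, ?_⟩
  · rw [h]; norm_num
  · rw [h]; norm_num
  · rw [h, one_div, ← Real.rpow_neg hn'.le]; norm_num
  · rw [h, one_div, ← Real.rpow_neg hn'.le]; norm_num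

theorem exists_mem_smallArc_le_norm_gapSeries {n d L : ℕ} {η : ℂ} {e : ℕ → ℂ}
    (hlog : 7 ≤ Real.log n) (hbig : 1000 * Real.log n ^ 12 ≤ (n : ℝ) ^ (3 / 5 : ℝ))
    (hLn : (n : ℝ) ^ (1 / 5 : ℝ) ≤ L)
    (hη : ‖η‖ ≤ 1) (hd : 1 ≤ d) (hL : 1 ≤ L) (h0 : ∀ j < L, e j = 0) (hb : ∀ j, ‖e j‖ ≤ 2) :
    ∃ z ∈ smallArc n, Real.exp (-(4000 * ((n : ℝ) ^ (1 / 5 : ℝ) * Real.log n ^ 5))) ≤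
      ‖gapSeries η d e z‖ := by
  have hn0 : 0 < n := by
    rcases Nat.eq_zero_or_pos n with rfl | h
    · norm_num at hlog
    · exact h
  by_contra! hcon
  have hρ : arcRadius n = 1 - (n : ℝ) ^ (-(4 / 5) : ℝ) * Real.log n ^ 6 := rfl
  have harc : ∀ θ : ℝ, |θ| ≤ (n : ℝ) ^ (-(2 / 5) : ℝ) →
      ‖gapSeries η d e ((arcRadius n : ℝ) * Complex.exp (θ * Complex.I))‖ ≤
        Real.exp (-(2 * (2000 * ((n : ℝ) ^ (1 / 5 : ℝ) * Real.log n ^ 5)))) := by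
    intro θ hθ
    refine (hcon _ ⟨θ, hθ, rfl⟩).le.trans_eq ?_
    congr 1; ring
  obtain ⟨p, hp, hn5, h1, h3, h2, h4⟩ := exists_fifth_root hn0
  rw [h1] at hLn harc
  rw [h2] at harc
  rw [h3] at hbig
  rw [h4] at hρ
  set T := Real.log n with hT
  have hTpow : ∀ k : ℕ, k ≤ 12 → T ^ k ≤ T ^ 12 := fun k hk =>
    pow_le_pow_right₀ (by linarith) hk
  have hT1 := hTpow 1 (by norm_num)
  have hT6 := hTpow 6 (by norm_num)
  rw [pow_one] at hT1
  have hp3 : 1000 * T ≤ p ^ 3 := by linarith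
  have hp1 : 1 ≤ p := by
    by_contra! hlt
    have := pow_le_one₀ hp.le hlt.le (n := 3)
    linarith
  have hn' : (1000 : ℝ) ≤ n := by
    rw [hn5]
    have : p ^ 3 ≤ p ^ 5 := pow_le_pow_right₀ hp1 (by norm_num)
    linarith
  -- Large enough that `π/m + 1/n`, after the logarithmic loss of the contact map, fits into a sixth
  -- of the half-angle `1/p²`.
  set m : ℕ := ⌈200 * p ^ 2 * T⌉₊ with hm
  have hm1 : 200 * p ^ 2 * T ≤ m := Nat.le_ceil _
  have hp2T : 1 ≤ p ^ 2 * T := by nlinarith [one_le_pow₀ hp1 (n := 2)]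
  have hm2 : (m : ℝ) ≤ 201 * p ^ 2 * T := by
    have := (Nat.ceil_lt_add_one (show 0 ≤ 200 * p ^ 2 * T by positivity)).le
    linarith
  have hm0 : (0 : ℝ) < m := by nlinarith
  have hmn : (m : ℝ) ≤ n := by
    rw [hn5]
    calc (m : ℝ) ≤ 201 * p ^ 2 * T := hm2
      _ = p ^ 2 * (201 * T) := by ring
      _ ≤ p ^ 2 * p ^ 3 := by gcongr; linarith
      _ = p ^ 5 := by ring
  have hpim : Real.pi / m ≤ 1 / (50 * p ^ 2 * T) := by
    rw [div_le_div_iff₀ hm0 (by positivity)]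
    have : Real.pi * (50 * p ^ 2 * T) ≤ 4 * (50 * p ^ 2 * T) := by
      gcongr; exact Real.pi_le_four
    linarith
  have hninv : 1 / (n : ℝ) ≤ 1 / (1000 * p ^ 2 * T) := by
    rw [hn5]
    refine one_div_le_one_div_of_le (by positivity) ?_
    calc 1000 * p ^ 2 * T = p ^ 2 * (1000 * T) := by ring
      _ ≤ p ^ 2 * p ^ 3 := by gcongr
      _ = p ^ 5 := by ring
  have hw : (Real.pi / m + 1 / n) * (7 + T) ≤ 42 / 1000 * (1 / p ^ 2) := by
    calc (Real.pi / m + 1 / n) * (7 + T)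
        ≤ (1 / (50 * p ^ 2 * T) + 1 / (1000 * p ^ 2 * T)) * (2 * T) := by gcongr; linarith
      _ = 42 / 1000 * (1 / p ^ 2) := by field_simp; norm_num
  have hp2 : 1 / p ^ 2 ≤ 1 := by
    rw [div_le_one (by positivity)]; exact one_le_pow₀ hp1
  have hp20 : 0 < 1 / p ^ 2 := by positivity
  have hpim2 : Real.pi / m ≤ 1 / 50 * (1 / p ^ 2) := by
    refine hpim.trans ?_
    rw [← one_div_mul_one_div_rev]
    rw [show 1 / 50 * (1 / p ^ 2) = 1 * (1 / (50 * p ^ 2)) by field_simp]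
    gcongr
    rw [div_le_one (by linarith)]; linarith
  have hx : 1 / p ^ 4 * T ^ 6 < 1 := by
    rw [one_div_mul_eq_div, div_lt_one (by positivity)]
    have : p ^ 3 ≤ p ^ 4 := pow_le_pow_right₀ hp1 (by norm_num)
    have : 0 < T ^ 6 := by positivity
    linarith
  -- `τ = 4T/p` and `L ≥ p` give `exp(τL) ≥ n^4`. The resulting bound `1 + 8T + 1608 p T^3`
  -- contradicts `M = 2000 p T^5`.
  have key := le_of_norm_gapSeries_le_on_arc (n := n) (m := m) (ρ := arcRadius n) (a := 1 / p ^ 2)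
    (τ := 4 * T / p) (M := 2000 * (p * T ^ 5)) (by exact_mod_cast (by linarith : (16 : ℝ) ≤ n))
    (by exact_mod_cast hm0) (by rw [hρ]; linarith) ?_ hp20 hp2 (by positivity) (by positivity)
    hη hd hL h0 hb ?_ (by linarith) (by linarith) harc
  · have e1 : 2 * T * (m * (4 * T / p)) ≤ 1608 * (p * T ^ 3) := by
      calc 2 * T * (m * (4 * T / p)) ≤ 2 * T * (201 * p ^ 2 * T * (4 * T / p)) := by gcongr
        _ = 1608 * (p * T ^ 3) := by field_simp; ring
    have e2 : p * T ^ 3 ≤ p * T ^ 5 := by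
      gcongr 1; exact pow_le_pow_right₀ (by linarith) (by norm_num)
    have e3 : T ≤ p * T ^ 5 := by
      calc T = 1 * T ^ 1 := by ring
        _ ≤ p * T ^ 5 := by
          exact mul_le_mul hp1 (pow_le_pow_right₀ (by linarith) (by norm_num)) (by positivity) hp.le
    rw [← hT] at key
    linarith
  · rw [hρ, hn5]
    have : 1 / p ^ 5 ≤ 1 / p ^ 4 * T ^ 6 := by
      calc 1 / p ^ 5 ≤ 1 / p ^ 4 :=
            one_div_le_one_div_of_le (by positivity) (pow_le_pow_right₀ hp1 (by norm_num))
        _ ≤ 1 / p ^ 4 * T ^ 6 := le_mul_of_one_le_right (by positivity)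
            (one_le_pow₀ (by linarith))
    linarith
  · calc 8 * (n : ℝ) ^ 2 * m ≤ n * (n : ℝ) ^ 2 * n := by gcongr; linarith
      _ = (n : ℝ) ^ 4 := by ring
      _ = Real.exp (4 * T) := by
        rw [show (4 : ℝ) * T = ((4 : ℕ) : ℝ) * T by norm_num, Real.exp_nat_mul, hT,
          Real.exp_log (by linarith)]
      _ ≤ Real.exp (4 * T / p * L) := by
        refine Real.exp_le_exp.mpr ?_
        calc 4 * T = 4 * T / p * p := by field_simp
          _ ≤ 4 * T / p * L := by gcongr

theorem norm_eq_arcRadius_of_mem_smallArc {n : ℕ} {z : ℂ} (hz : z ∈ smallArc n)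
    (h : 0 ≤ arcRadius n) : ‖z‖ = arcRadius n := by
  obtain ⟨θ, -, rfl⟩ := hz
  rw [norm_mul, Complex.norm_exp_ofReal_mul_I, mul_one, Complex.norm_real, Real.norm_of_nonneg h]

/-- With `x = T^6/p^4`, `log(1 - x) ≥ -x - 2x²`. Here `nx = p T^6` is the main term and `2nx² =
2T^12/p^3` is at most `1`. -/
theorem exp_le_arcRadius_pow {n : ℕ} (hlog : 7 ≤ Real.log n)
    (hbig : 1000 * Real.log n ^ 12 ≤ (n : ℝ) ^ (3 / 5 : ℝ)) :
    0 < arcRadius n ∧ arcRadius n < 1 ∧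
    Real.exp (-((n : ℝ) ^ (1 / 5 : ℝ) * Real.log n ^ 6) -
      (n : ℝ) ^ (1 / 5 : ℝ) * Real.log n ^ 5) ≤ arcRadius n ^ n := by
  have hn0 : 0 < n := by
    rcases Nat.eq_zero_or_pos n with rfl | h
    · norm_num at hlog
    · exact h
  have hρ : arcRadius n = 1 - (n : ℝ) ^ (-(4 / 5) : ℝ) * Real.log n ^ 6 := rfl
  obtain ⟨p, hp, hn5, h1, h3, h2, h4⟩ := exists_fifth_root hn0
  rw [h3] at hbig
  rw [h4] at hρ
  rw [h1]
  set T := Real.log n with hT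
  have hT6 : T ^ 6 ≤ T ^ 12 := pow_le_pow_right₀ (by linarith) (by norm_num)
  have hT60 : 1 ≤ T ^ 6 := one_le_pow₀ (by linarith)
  have hp1 : 1 ≤ p := by
    by_contra! hlt
    have := pow_le_one₀ hp.le hlt.le (n := 3)
    linarith
  set x := 1 / p ^ 4 * T ^ 6 with hx
  have hx0 : 0 < x := by positivity
  have hx2 : x ≤ 1 / 2 := by
    rw [hx, one_div_mul_eq_div, div_le_iff₀ (by positivity)]
    have : p ^ 3 ≤ p ^ 4 := pow_le_pow_right₀ hp1 (by norm_num)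
    linarith
  refine ⟨by linarith, by linarith, ?_⟩
  have hlogx : -x - 2 * x ^ 2 ≤ Real.log (arcRadius n) := by
    rw [hρ]
    refine le_trans ?_ (Real.one_sub_inv_le_log_of_pos (by linarith))
    have : (1 - x)⁻¹ ≤ 1 + x + 2 * x ^ 2 := by
      rw [inv_le_iff_one_le_mul₀ (by linarith)]
      nlinarith [mul_nonneg (sq_nonneg x) (by linarith : 0 ≤ 1 - 2 * x)]
    linarith
  have hpow : arcRadius n ^ n = Real.exp (n * Real.log (arcRadius n)) := by
    rw [Real.exp_nat_mul, Real.exp_log (by linarith)]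
  rw [hpow]
  refine Real.exp_le_exp.mpr ?_
  have e1 : (n : ℝ) * x = p * T ^ 6 := by rw [hn5, hx]; field_simp
  have e2 : (n : ℝ) * (2 * x ^ 2) = 2 * T ^ 12 / p ^ 3 := by rw [hn5, hx]; field_simp
  have e3 : 2 * T ^ 12 / p ^ 3 ≤ 1 := by
    rw [div_le_one (by positivity)]; linarith [hT60.trans hT6]
  have e4 : 1 ≤ p * T ^ 5 := one_le_mul_of_one_le_of_one_le hp1 (one_le_pow₀ (by linarith))
  have e5 : (n : ℝ) * (-x - 2 * x ^ 2) ≤ n * Real.log (arcRadius n) := by gcongr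
  linarith

/-! ### Word periods and reduction to a gap series -/

/-- `p` is a period of the word `w`. -/
def HasWordPeriod {l : ℕ} (w : Fin l → Fin 2) (p : ℕ) : Prop :=
  ∀ i j : Fin l, (j : ℕ) = i + p → w i = w j

theorem hasWordPeriod_of_factor_eq {s : ℕ → Fin 2} {l k p : ℕ} {w : Fin l → Fin 2}
    (h1 : factor s k l = w) (h2 : factor s (k + p) l = w) : HasWordPeriod w p := by
  intro i j hij
  rw [← congrFun h1 j, ← congrFun h2 i, factor, factor, hij]
  congr 1
  ring

/-- Two words that differ only in their last letter do not both have short periods. -/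
theorem not_hasWordPeriod_and_hasWordPeriod {x y : ℕ → Fin 2} {n l p q : ℕ} (hl : l ≤ n)
    (hxy : ∀ i < n, x i = y i) (hn : x n ≠ y n) (hp : 0 < p) (hq : 0 < q) (hpq : p + q < l) :
    ¬(HasWordPeriod (factor x (n - l + 1) l) p ∧ HasWordPeriod (factor y (n - l + 1) l) q) := by
  rintro ⟨hx, hy⟩
  have hx' : ∀ i, i + p < l → x (n - l + 1 + i) = x (n - l + 1 + (i + p)) := fun i hi =>
    hx ⟨i, by omega⟩ ⟨i + p, hi⟩ rfl
  have hy' : ∀ i, i + q < l → y (n - l + 1 + i) = y (n - l + 1 + (i + q)) := fun i hi =>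
    hy ⟨i, by omega⟩ ⟨i + q, hi⟩ rfl
  -- The periods link positions `n`, `n-p`, `n-q`, `n-p-q`, all inside the word: `x_n = x_{n-p} =
  -- y_{n-p} = y_{n-p-q} = x_{n-p-q} = x_{n-q} = y_{n-q} = y_n`.
  have h1 := hx' (l - 1 - p) (by omega)
  have h2 := hy' (l - 1 - q) (by omega)
  have h3 := hx' (l - 1 - p - q) (by omega)
  have h4 := hy' (l - 1 - p - q) (by omega)
  rw [show n - l + 1 + (l - 1 - p + p) = n by omega] at h1
  rw [show n - l + 1 + (l - 1 - q + q) = n by omega] at h2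
  rw [show l - 1 - p - q + p = l - 1 - q by omega] at h3
  rw [show l - 1 - p - q + q = l - 1 - p by omega] at h4
  apply hn
  rw [← h1, ← h2, ← hxy _ (by omega), ← h3, hxy _ (by omega), ← h4, ← hxy _ (by omega)]

theorem signedOccurrence_of_ne {l : ℕ} {x : ℕ → Fin 2} {w : Fin l → Fin 2} {k : ℕ}
    (h : factor x (k + 1) l ≠ w) : signedOccurrence x w k = 0 := by
  simp [signedOccurrence, h]

theorem norm_signedOccurrence_of_eq {l : ℕ} {x : ℕ → Fin 2} {w : Fin l → Fin 2} {k : ℕ}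
    (h : factor x (k + 1) l = w) : ‖signedOccurrence x w k‖ = 1 := by
  simp [signedOccurrence, h]

theorem norm_signedOccurrence_le {l : ℕ} (x : ℕ → Fin 2) (w : Fin l → Fin 2) (k : ℕ) :
    ‖signedOccurrence x w k‖ ≤ 1 := by
  by_cases h : factor x (k + 1) l = w
  · exact (norm_signedOccurrence_of_eq h).le
  · simp [signedOccurrence_of_ne h]

theorem norm_signedOccurrence_sub_le {l : ℕ} (x y : ℕ → Fin 2) (w : Fin l → Fin 2) (k : ℕ) :
    ‖signedOccurrence x w k - signedOccurrence y w k‖ ≤ 2 :=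
  (norm_sub_le _ _).trans (by
    linarith [norm_signedOccurrence_le x w k, norm_signedOccurrence_le y w k])

theorem signedOccurrence_eq_of_lt {x y : ℕ → Fin 2} {n l k : ℕ} (w : Fin l → Fin 2)
    (hxy : ∀ i < n, x i = y i) (hk : k + l < n) :
    signedOccurrence x w k = signedOccurrence y w k := by
  have h : factor x (k + 1) l = factor y (k + 1) l :=
    funext fun i => hxy _ (by have := i.isLt; omega)
  rw [signedOccurrence, signedOccurrence, h, hxy k (by omega)]

/-- After division by its first coefficient, a coefficient sequence of modulus at most `2` that
has at most one other nonzero entry before index `L` defines a gap series. -/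
theorem exists_tsum_eq_mul_gapSeries {c : ℕ → ℂ} {L : ℕ} (hL : 1 ≤ L) (h0 : ‖c 0‖ = 1)
    (hb : ∀ j, ‖c j‖ ≤ 2) (hb1 : ∀ j, 0 < j → j < L → ‖c j‖ ≤ 1)
    (hu : ∀ i j, 0 < i → i < L → 0 < j → j < L → c i ≠ 0 → c j ≠ 0 → i = j) :
    ∃ (η : ℂ) (d : ℕ) (e : ℕ → ℂ), ‖η‖ ≤ 1 ∧ 1 ≤ d ∧ (∀ j < L, e j = 0) ∧ (∀ j, ‖e j‖ ≤ 2) ∧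
      ∀ z : ℂ, ‖z‖ < 1 → ∑' j, c j * z ^ j = c 0 * gapSeries η d e z := by
  have hc0 : c 0 ≠ 0 := by rw [← norm_ne_zero_iff, h0]; norm_num
  obtain ⟨η, d, hη, hd, hdL, hcd⟩ : ∃ (η : ℂ) (d : ℕ), ‖η‖ ≤ 1 ∧ 1 ≤ d ∧ (η = 0 ∨ d < L) ∧
      ∀ j, 0 < j → j < L → c j = c 0 * -(if j = d then η else 0) := by
    by_cases h : ∃ d, 0 < d ∧ d < L ∧ c d ≠ 0
    · obtain ⟨d, hd0, hdL, hcd⟩ := h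
      refine ⟨-(c d / c 0), d, ?_, hd0, Or.inr hdL, fun j hj hjL => ?_⟩
      · rw [norm_neg, norm_div, h0, div_one]; exact hb1 d hd0 hdL
      · split_ifs with hjd
        · rw [hjd]; field_simp
        · by_contra hne
          exact hjd (hu j d hj hjL hd0 hdL (by simpa using hne) hcd)
    · push Not at h
      -- The default degree `1` equals `L` when `L = 1`, so `d < L` is demanded only if `η ≠ 0`.
      exact ⟨0, 1, by simp, le_rfl, Or.inl rfl, fun j hj hjL => by simp [h j hj hjL]⟩
  set e : ℕ → ℂ := fun j => if j < L then 0 else c j / c 0 with he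
  have heb : ∀ j, ‖e j‖ ≤ 2 := by
    intro j
    simp only [he]
    split_ifs
    · simp
    · rw [norm_div, h0, div_one]; exact hb j
  refine ⟨η, d, e, hη, hd, fun j hj => if_pos hj, heb, fun z hz => ?_⟩
  have hs1 : HasSum (fun j => (if j = 0 then 1 else 0) * z ^ j) (1 : ℂ) := by
    have := hasSum_single (f := fun j => (if j = 0 then (1 : ℂ) else 0) * z ^ j) 0
      (fun j hj => by simp [hj])
    simpa using this
  have hs2 : HasSum (fun j => (if j = d then η else 0) * z ^ j) (η * z ^ d) := by
    have := hasSum_single (f := fun j => (if j = d then η else 0) * z ^ j) d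
      (fun j hj => by simp [hj])
    simpa using this
  have hs3 := (summable_norm_mul_pow_of_norm_le heb hz).of_norm.hasSum
  have hs := ((hs1.sub hs2).add hs3).mul_left (c 0)
  rw [gapSeries, ← hs.tsum_eq]
  refine tsum_congr fun j => ?_
  rw [← sub_mul, ← add_mul, ← mul_assoc]
  congr 1
  rcases Nat.eq_zero_or_pos j with rfl | hj
  · have h1 : ¬ 0 = d := by omega
    have h2 : 0 < L := hL
    simp [he, h1, h2]
  · by_cases hjL : j < L
    · simp [hcd j hj hjL, he, hjL, hj.ne']
    · have h1 : (if j = d then η else 0) = 0 := by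
        split_ifs with hjd
        · exact hdL.resolve_right (by omega)
        · rfl
      rw [h1]
      simp only [he, if_neg hjL, if_neg hj.ne']
      field_simp
      ring

theorem tsum_eq_pow_mul_tsum_shift {c : ℕ → ℂ} {k : ℕ} (hb : ∀ j, ‖c j‖ ≤ 2)
    (h0 : ∀ j < k, c j = 0) {z : ℂ} (hz : ‖z‖ < 1) :
    ∑' j, c j * z ^ j = z ^ k * ∑' j, c (k + j) * z ^ j := by
  rw [← (summable_norm_mul_pow_of_norm_le hb hz).of_norm.sum_add_tsum_nat_add k,
    Finset.sum_eq_zero, zero_add, ← tsum_mul_left]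
  · refine tsum_congr fun j => ?_
    rw [add_comm j k, pow_add]; ring
  · intro j hj
    rw [h0 j (Finset.mem_range.mp hj), zero_mul]

/-- Take `w` to be the factor of `x` ending at `n`; the first nonzero coefficient has index `n - l`
and comes from `x` alone. Another occurrence in `x` at a shift below `L`, or two in `y`, would give
`w` a period below `L`. So at most one further coefficient precedes the gap. -/
theorem exists_gapSeries_of_not_hasWordPeriod {x y : ℕ → Fin 2} {n l L : ℕ} (hl : l ≤ n)
    (hl0 : 0 < l) (hL : 1 ≤ L) (hxy : ∀ i < n, x i = y i) (hn : x n ≠ y n)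
    (hper : ∀ p, 0 < p → p < L → ¬ HasWordPeriod (factor x (n - l + 1) l) p) :
    ∃ (w : Fin l → Fin 2) (η : ℂ) (d : ℕ) (e : ℕ → ℂ),
      ‖η‖ ≤ 1 ∧ 1 ≤ d ∧ (∀ j < L, e j = 0) ∧ (∀ j, ‖e j‖ ≤ 2) ∧ ∀ z : ℂ, ‖z‖ < 1 →
        ‖∑' k, (signedOccurrence x w k - signedOccurrence y w k) * z ^ k‖ =
          ‖z‖ ^ (n - l) * ‖gapSeries η d e z‖ := by
  set w := factor x (n - l + 1) l with hw
  set c : ℕ → ℂ := fun k => signedOccurrence x w k - signedOccurrence y w k with hc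
  have hbd : ∀ k, ‖c k‖ ≤ 2 := norm_signedOccurrence_sub_le x y w
  have hx0 : ∀ j, 0 < j → j < L → signedOccurrence x w (n - l + j) = 0 := by
    intro j hj hjL
    refine signedOccurrence_of_ne fun h => hper j hj hjL ?_
    exact hasWordPeriod_of_factor_eq (k := n - l + 1) hw.symm
      (by rw [← h]; congr 1; ring)
  have hy0 : signedOccurrence y w (n - l) = 0 := by
    refine signedOccurrence_of_ne fun h => hn ?_
    have h1 := congrFun h ⟨l - 1, by omega⟩
    simp only [hw, factor] at h1
    rw [show n - l + 1 + (l - 1) = n by omega] at h1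
    exact h1.symm
  have hyne : ∀ k, signedOccurrence y w k ≠ 0 → factor y (k + 1) l = w := fun k h => by
    by_contra hne
    exact h (signedOccurrence_of_ne hne)
  have huniq : ∀ i j, 0 < i → i < j → j < L → c (n - l + i) ≠ 0 → c (n - l + j) ≠ 0 → False := by
    intro i j hi hij hjL hci hcj
    simp only [hc, hx0 i hi (by omega), hx0 j (by omega) hjL, zero_sub, ne_eq, neg_eq_zero]
      at hci hcj
    refine hper (j - i) (by omega) (by omega) ?_
    refine hasWordPeriod_of_factor_eq (hyne _ hci) ?_
    rw [← hyne _ hcj]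
    congr 1
    omega
  obtain ⟨η, d, e, hη, hd, he0, heb, hsum⟩ :=
    exists_tsum_eq_mul_gapSeries (c := fun j => c (n - l + j)) hL
      (by simp only [hc, add_zero, hy0, sub_zero]; exact norm_signedOccurrence_of_eq hw.symm)
      (fun j => hbd _)
      (fun j hj hjL => by
        simp only [hc, hx0 j hj hjL, zero_sub, norm_neg]; exact norm_signedOccurrence_le _ _ _)
      (fun i j hi hiL hj hjL hci hcj => by
        rcases lt_trichotomy i j with h | h | h
        · exact (huniq i j hi h hjL hci hcj).elim
        · exact h
        · exact (huniq j i hj h hiL hcj hci).elim)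
  refine ⟨w, η, d, e, hη, hd, he0, heb, fun z hz => ?_⟩
  have h1 : ‖c (n - l)‖ = 1 := by
    simp only [hc, hy0, sub_zero]; exact norm_signedOccurrence_of_eq hw.symm
  have h2 := tsum_eq_pow_mul_tsum_shift (c := c) (k := n - l) hbd
    (fun j hj => sub_eq_zero.mpr (signedOccurrence_eq_of_lt w hxy (by omega))) hz
  rw [hsum z hz] at h2
  rw [h2, norm_mul, norm_mul, norm_pow, add_zero, h1, one_mul]

/-- If the factor of `x` has a period below `L`, exchange `x` and `y`: two such periods sum to at
most `2(L - 1) < l`, so the factor of `y` has none. -/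
theorem exists_gapSeries_of_ne {x y : ℕ → Fin 2} {n l L : ℕ} (hl : l ≤ n)
    (hl0 : 0 < l) (hL : 1 ≤ L) (hLl : 2 * (L - 1) < l) (hxy : ∀ i < n, x i = y i)
    (hn : x n ≠ y n) :
    ∃ (w : Fin l → Fin 2) (η : ℂ) (d : ℕ) (e : ℕ → ℂ),
      ‖η‖ ≤ 1 ∧ 1 ≤ d ∧ (∀ j < L, e j = 0) ∧ (∀ j, ‖e j‖ ≤ 2) ∧ ∀ z : ℂ, ‖z‖ < 1 →
        ‖∑' k, (signedOccurrence x w k - signedOccurrence y w k) * z ^ k‖ =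
          ‖z‖ ^ (n - l) * ‖gapSeries η d e z‖ := by
  by_cases h : ∀ p, 0 < p → p < L → ¬ HasWordPeriod (factor x (n - l + 1) l) p
  · exact exists_gapSeries_of_not_hasWordPeriod hl hl0 hL hxy hn h
  · push Not at h
    obtain ⟨p, hp, hpL, hper⟩ := h
    obtain ⟨w, η, d, e, hη, hd, he0, heb, hsum⟩ :=
      exists_gapSeries_of_not_hasWordPeriod hl hl0 hL (fun i hi => (hxy i hi).symm) hn.symm
        (fun q hq hqL hper' => not_hasWordPeriod_and_hasWordPeriod hl hxy hn hp hq (by omega)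
          ⟨hper, hper'⟩)
    refine ⟨w, η, d, e, hη, hd, he0, heb, fun z hz => ?_⟩
    rw [← hsum z hz, ← norm_neg, ← tsum_neg]
    congr 2
    funext k
    ring

/-! ### Assembly -/

theorem mainTheorem8 :
    ∃ C : ℝ, 0 < C ∧ ∃ N : ℕ, ∀ n : ℕ, N ≤ n → ∀ x y : ℕ → Fin 2,
      (∀ i : ℕ, i < n → x i = y i) → x n ≠ y n →
      ∃ w : Fin (wordLength n) → Fin 2, ∃ z₀ ∈ smallArc n,
        Summable (fun k : ℕ => (signedOccurrence x w k - signedOccurrence y w k) * z₀ ^ k) ∧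
        Real.exp (-((n : ℝ) ^ (1 / 5 : ℝ) * Real.log n ^ 6)
            - C * ((n : ℝ) ^ (1 / 5 : ℝ) * Real.log n ^ 5)) ≤
          ‖∑' k : ℕ, (signedOccurrence x w k - signedOccurrence y w k) * z₀ ^ k‖ := by
  obtain ⟨N, hN⟩ := Filter.eventually_atTop.mp eventually_log_pow_le_rpow
  -- `4000` from the gap series and `1` from the power of the radius; `N + 1` makes `n` positive.
  refine ⟨4001, by norm_num, N + 1, fun n hn x y hxy hne => ?_⟩
  obtain ⟨hlog, hbig⟩ := hN n (by omega)
  obtain ⟨hρ0, hρ1, hρn⟩ := exp_le_arcRadius_pow hlog hbig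
  have hp0 : (0 : ℝ) ≤ (n : ℝ) ^ (1 / 5 : ℝ) := by positivity
  have hl1 : (2 * (n : ℝ) ^ (1 / 5 : ℝ)) < wordLength n := by
    have := Nat.lt_floor_add_one (2 * (n : ℝ) ^ (1 / 5 : ℝ))
    rw [wordLength, Nat.floor_add_one (by positivity)]
    exact_mod_cast this
  have hl0 : 0 < wordLength n := by
    have : (0 : ℝ) < wordLength n := by linarith
    exact_mod_cast this
  have hln : wordLength n ≤ n := by
    obtain ⟨p, hp, hn5, h1, h3, -⟩ := exists_fifth_root (show 0 < n by omega)
    have hle : 1 ≤ Real.log n ^ 12 := one_le_pow₀ (by linarith)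
    have h4 : (wordLength n : ℝ) ≤ 2 * p + 1 := by
      rw [wordLength, ← h1]; exact Nat.floor_le (by positivity)
    have hp3 : 1000 ≤ p ^ 3 := by rw [← h3]; linarith
    have hp1 : 1 ≤ p := by
      by_contra! hlt
      have := pow_le_one₀ hp.le hlt.le (n := 3)
      linarith
    have : (wordLength n : ℝ) ≤ n := by
      rw [hn5]
      nlinarith [mul_le_mul hp3 (one_le_pow₀ hp1 (n := 2)) zero_le_one (by positivity)]
    exact_mod_cast this
  -- This `L` is the largest with `2(L - 1) < l`, and `2L ≥ l > 2 n^(1/5)`.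
  have hL : (n : ℝ) ^ (1 / 5 : ℝ) ≤ ((wordLength n - 1) / 2 + 1 : ℕ) := by
    have h1 : wordLength n ≤ 2 * ((wordLength n - 1) / 2 + 1) := by omega
    have h2 : (wordLength n : ℝ) ≤ 2 * ((wordLength n - 1) / 2 + 1 : ℕ) := by exact_mod_cast h1
    linarith
  obtain ⟨w, η, d, e, hη, hd, he0, heb, hsum⟩ :=
    exists_gapSeries_of_ne hln hl0 (L := (wordLength n - 1) / 2 + 1) (by omega) (by omega) hxy hne
  obtain ⟨z, hz, hzle⟩ := exists_mem_smallArc_le_norm_gapSeries hlog hbig hL hη hd (by omega) he0 heb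
  have hzn := norm_eq_arcRadius_of_mem_smallArc hz hρ0.le
  have hz1 : ‖z‖ < 1 := by rw [hzn]; exact hρ1
  refine ⟨w, z, hz, (summable_norm_mul_pow_of_norm_le
    (norm_signedOccurrence_sub_le x y w) hz1).of_norm, ?_⟩
  rw [hsum z hz1, hzn]
  calc _ = Real.exp (-((n : ℝ) ^ (1 / 5 : ℝ) * Real.log n ^ 6) -
        (n : ℝ) ^ (1 / 5 : ℝ) * Real.log n ^ 5) *
        Real.exp (-(4000 * ((n : ℝ) ^ (1 / 5 : ℝ) * Real.log n ^ 5))) := by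
        rw [← Real.exp_add]; congr 1; ring
    _ ≤ arcRadius n ^ (n - wordLength n) * ‖gapSeries η d e z‖ := by
        gcongr
        exact hρn.trans (pow_le_pow_of_le_one hρ0.le hρ1.le (Nat.sub_le _ _))
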